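/- Let $s>0$ and let $S^2=\{S_1^2+S_2^2+S_3^2=s^2\}\subset\mathbb R^3$ be the sphere of radius $s$. Let $\mathcal P=\mathbb R[S_1,S_2,S_3]/(S_1^2+S_2^2+S_3^2-s^2)$ be the Poisson algebra of polynomials on $S^2$, with Poisson bracket $\{f,g\}=\sum_{i,j,k}\epsilon_{ijk}S_i\,\frac{\partial f}{\partial S_j}\frac{\partial g}{\partial S_k}$. Let $\mathcal P^1=\operatorname{span}\{1,S_1,S_2,S_3\}$, let $\mathcal O\subset\mathcal P$ be the Poisson subalgebra of odd polynomials (the classes of polynomials all of whose terms have odd degree), and let $\tilde{\mathcal O}=\mathcal O\oplus\mathbb R$, so that $\mathcal P^1\subset\tilde{\mathcal O}$. A quantization of $\tilde{\mathcal O}$ on a complex Hilbert space $H$ is a real-linear map $\mathcal Q$ from $\tilde{\mathcal O}$ to the operators that map a common dense domain $D\subseteq H$ into itself and are essentially self-adjoint on $D$ (for bounded operators, $D=H$), such that $\mathcal Q(\{f,g\})=-\mathrm i\,[\mathcal Q(f),\mathcal Q(g)]$ for all $f,g\in\tilde{\mathcal O}$ and $\mathcal Q(1)=I$. It is an admissible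 quantization of $(\tilde{\mathcal O},\mathcal P^1)$ if $\mathcal P^1$ is represented irreducibly, i.e. $H\neq 0$ and the only closed subspaces of $H$ whose orthogonal projection commutes with the closures of all $\mathcal Q(f)$, $f\in\mathcal P^1$, are $0$ and $H$, and integrably, i.e. $\sum_{i=1}^3\mathcal Q(S_i)^2$ is essentially self-adjoint on $D$ (automatic for bounded operators with $D=H$). It is trivial if $\mathcal P^1$ is represented with spin $0$, i.e. $\dim H=1$ and $\mathcal Q(S_1)=\mathcal Q(S_2)=\mathcal Q(S_3)=0$. Theorem. For every $s>0$ and every complex Hilbert space $H$, there does not exist a nontrivial admissible quantization of $(\tilde{\mathcal O},\mathcal P^1)$ on $H$. -/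

import Mathlib

open MvPolynomial

noncomputable section

namespace SphereQuantization

/-! ### The Poisson algebra of polynomials on the sphere of radius `s` -/

/-- The Poisson bracket `{f, g} = ∑ ε_{ijk} S_i (∂f/∂S_j) (∂g/∂S_k) = S · (∇f × ∇g)` of two
polynomials in the variables `S_1, S_2, S_3`, which are written `X 0, X 1, X 2`. -/
def polyBracket (f g : MvPolynomial (Fin 3) ℝ) : MvPolynomial (Fin 3) ℝ :=
  X 0 * (pderiv 1 f * pderiv 2 g - pderiv 2 f * pderiv 1 g) +
  X 1 * (pderiv 2 f * pderiv 0 g - pderiv 0 f * pderiv 2 g) +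
  X 2 * (pderiv 0 f * pderiv 1 g - pderiv 1 f * pderiv 0 g)

/-- The ideal generated by `S_1² + S_2² + S_3² - s²`. -/
def sphereIdeal (s : ℝ) : Ideal (MvPolynomial (Fin 3) ℝ) :=
  Ideal.span {X 0 ^ 2 + X 1 ^ 2 + X 2 ^ 2 - C (s ^ 2)}

/-- The algebra `𝒫` of polynomials in the components of the spin vector, modulo the relation
`S_1² + S_2² + S_3² = s²`. -/
abbrev SpherePoly (s : ℝ) : Type := MvPolynomial (Fin 3) ℝ ⧸ sphereIdeal s

/-- The class of a polynomial, as a real-linear map. -/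
def toSphere (s : ℝ) : MvPolynomial (Fin 3) ℝ →ₗ[ℝ] SpherePoly s :=
  (Ideal.Quotient.mkₐ ℝ (sphereIdeal s)).toLinearMap

theorem polyBracket_add_left (f f' g : MvPolynomial (Fin 3) ℝ) :
    polyBracket (f + f') g = polyBracket f g + polyBracket f' g := by
  simp only [polyBracket, map_add]; ring

theorem polyBracket_smul_left (c : ℝ) (f g : MvPolynomial (Fin 3) ℝ) :
    polyBracket (c • f) g = c • polyBracket f g := by
  simp only [polyBracket, MvPolynomial.smul_eq_C_mul, pderiv_C_mul]; ring

theorem polyBracket_swap (f g : MvPolynomial (Fin 3) ℝ) :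
    polyBracket g f = - polyBracket f g := by
  simp only [polyBracket]; ring

/-- The ideal of the sphere is stable under brackets, since `S_1² + S_2² + S_3²` is a Casimir. -/
theorem polyBracket_mem_left {s : ℝ} {f : MvPolynomial (Fin 3) ℝ} (hf : f ∈ sphereIdeal s)
    (g : MvPolynomial (Fin 3) ℝ) : polyBracket f g ∈ sphereIdeal s := by
  obtain ⟨h, rfl⟩ := Ideal.mem_span_singleton'.1 hf
  have key : polyBracket (h * (X 0 ^ 2 + X 1 ^ 2 + X 2 ^ 2 - C (s ^ 2))) g =
      polyBracket h g * (X 0 ^ 2 + X 1 ^ 2 + X 2 ^ 2 - C (s ^ 2)) := by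
    simp [polyBracket, pderiv_X]
    ring
  rw [key]
  exact Ideal.mul_mem_left _ _ (Ideal.subset_span rfl)

theorem polyBracket_congr {s : ℝ} {f f' g g' : MvPolynomial (Fin 3) ℝ}
    (hf : f - f' ∈ sphereIdeal s) (hg : g - g' ∈ sphereIdeal s) :
    polyBracket f g - polyBracket f' g' ∈ sphereIdeal s := by
  have h : polyBracket f g - polyBracket f' g' =
      polyBracket (f - f') g - polyBracket (g - g') f' := by
    simp only [polyBracket, map_sub]; ring
  rw [h]
  exact Ideal.sub_mem _ (polyBracket_mem_left hf g) (polyBracket_mem_left hg f')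

/-- The Poisson bracket of `𝒫`, computed on arbitrary polynomial representatives. -/
def poisson {s : ℝ} (a b : SpherePoly s) : SpherePoly s :=
  Quotient.liftOn₂' a b (fun f g => toSphere s (polyBracket f g)) (by
    intro f g f' g' hf hg
    exact Ideal.Quotient.eq.2 (polyBracket_congr
      ((Submodule.quotientRel_def _).1 hf) ((Submodule.quotientRel_def _).1 hg)))

theorem toSphere_surjective (s : ℝ) : Function.Surjective (toSphere s) :=
  Ideal.Quotient.mk_surjective

theorem poisson_toSphere {s : ℝ} (f g : MvPolynomial (Fin 3) ℝ) :
    poisson (toSphere s f) (toSphere s g) = toSphere s (polyBracket f g) := rfl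

theorem poisson_add_left {s : ℝ} (a a' b : SpherePoly s) :
    poisson (a + a') b = poisson a b + poisson a' b := by
  obtain ⟨f, rfl⟩ := toSphere_surjective s a
  obtain ⟨f', rfl⟩ := toSphere_surjective s a'
  obtain ⟨g, rfl⟩ := toSphere_surjective s b
  rw [← map_add, poisson_toSphere, polyBracket_add_left, map_add]; rfl

theorem poisson_smul_left {s : ℝ} (c : ℝ) (a b : SpherePoly s) :
    poisson (c • a) b = c • poisson a b := by
  obtain ⟨f, rfl⟩ := toSphere_surjective s a
  obtain ⟨g, rfl⟩ := toSphere_surjective s b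
  rw [← map_smul, poisson_toSphere, polyBracket_smul_left, map_smul]; rfl

theorem poisson_swap {s : ℝ} (a b : SpherePoly s) : poisson b a = - poisson a b := by
  obtain ⟨f, rfl⟩ := toSphere_surjective s a
  obtain ⟨g, rfl⟩ := toSphere_surjective s b
  rw [poisson_toSphere, poisson_toSphere, polyBracket_swap, map_neg]

/-- A bracket of two elements of a span lies in any subspace that contains the brackets of the
spanning elements. -/
theorem poisson_mem_of_span {s : ℝ} {G : Set (SpherePoly s)} {V : Submodule ℝ (SpherePoly s)}
    (h : ∀ a ∈ G, ∀ b ∈ G, poisson a b ∈ V) {a b : SpherePoly s}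
    (ha : a ∈ Submodule.span ℝ G) (hb : b ∈ Submodule.span ℝ G) : poisson a b ∈ V := by
  have zero_left : ∀ c : SpherePoly s, poisson 0 c = 0 := fun c => by
    have := poisson_smul_left (0 : ℝ) (0 : SpherePoly s) c
    simpa using this
  induction ha using Submodule.span_induction with
  | mem a ha =>
    rw [poisson_swap]
    refine V.neg_mem ?_
    induction hb using Submodule.span_induction with
    | mem b hb => exact h b hb a ha
    | zero => rw [zero_left]; exact V.zero_mem
    | add x y _ _ hx hy => rw [poisson_add_left]; exact V.add_mem hx hy
    | smul c x _ hx => rw [poisson_smul_left]; exact V.smul_mem c hx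
  | zero => rw [zero_left]; exact V.zero_mem
  | add x y _ _ hx hy => rw [poisson_add_left]; exact V.add_mem hx hy
  | smul c x _ hx => rw [poisson_smul_left]; exact V.smul_mem c hx

/-- A Poisson subalgebra of `𝒫`: a real subspace closed under the Poisson bracket. -/
structure PoissonSubalgebra (s : ℝ) extends Submodule ℝ (SpherePoly s) where
  poisson_mem : ∀ {a b : SpherePoly s}, a ∈ toSubmodule → b ∈ toSubmodule →
    poisson a b ∈ toSubmodule

/-- The component `S_i` of the spin vector, as an element of `𝒫`. -/
def spin (s : ℝ) (i : Fin 3) : SpherePoly s := toSphere s (X i)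

theorem toSphere_one (s : ℝ) : toSphere s 1 = 1 := rfl

theorem poisson_one_left {s : ℝ} (b : SpherePoly s) : poisson 1 b = 0 := by
  obtain ⟨g, rfl⟩ := toSphere_surjective s b
  rw [← toSphere_one, poisson_toSphere]
  simp [polyBracket]

theorem poisson_one_right {s : ℝ} (b : SpherePoly s) : poisson b 1 = 0 := by
  rw [poisson_swap, poisson_one_left, neg_zero]

/-- `{1, S_1, S_2, S_3}`. -/
def basicSet (s : ℝ) : Set (SpherePoly s) := {1} ∪ Set.range (spin s)

/-- `𝒫¹ = span {1, S_1, S_2, S_3}`, the polynomials of degree at most one. -/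
def linearPoly (s : ℝ) : PoissonSubalgebra s where
  toSubmodule := Submodule.span ℝ (basicSet s)
  poisson_mem := by
    refine fun ha hb => poisson_mem_of_span ?_ ha hb
    have hs : ∀ i, toSphere s (X i) ∈ Submodule.span ℝ (basicSet s) := fun i =>
      Submodule.subset_span (Or.inr ⟨i, rfl⟩)
    rintro a (rfl | ⟨i, rfl⟩) b (rfl | ⟨j, rfl⟩)
    · rw [poisson_one_left]; exact Submodule.zero_mem _
    · rw [poisson_one_left]; exact Submodule.zero_mem _
    · rw [poisson_one_right]; exact Submodule.zero_mem _
    · rw [spin, spin, poisson_toSphere]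
      fin_cases i <;> fin_cases j <;>
        simp [polyBracket, pderiv_X, hs]

/-- `𝒪`: the classes of the polynomials all of whose terms are of odd degree. -/
def oddPoly (s : ℝ) : Submodule ℝ (SpherePoly s) :=
  (restrictSupport ℝ {d : Fin 3 →₀ ℕ | Odd d.degree}).map (toSphere s)

/-- The polynomials all of whose terms have a degree of parity `e`. -/
def parityPoly (e : ZMod 2) : Submodule ℝ (MvPolynomial (Fin 3) ℝ) :=
  restrictSupport ℝ {d : Fin 3 →₀ ℕ | (d.degree : ZMod 2) = e}

theorem parityPoly_one :
    parityPoly 1 = restrictSupport ℝ {d : Fin 3 →₀ ℕ | Odd d.degree} := by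
  unfold parityPoly
  congr 1
  ext d
  exact ZMod.natCast_eq_one_iff_odd

theorem X_mem_parityPoly (i : Fin 3) : X i ∈ parityPoly 1 := by
  rw [parityPoly, X, monomial_mem_restrictSupport]
  left
  simp

theorem mul_mem_parityPoly {e e' : ZMod 2} {f g : MvPolynomial (Fin 3) ℝ}
    (hf : f ∈ parityPoly e) (hg : g ∈ parityPoly e') : f * g ∈ parityPoly (e + e') := by
  classical
  intro d hd
  obtain ⟨a, ha, b, hb, rfl⟩ := Finset.mem_add.1 (support_mul f g hd)
  have h1 : (a.degree : ZMod 2) = e := hf ha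
  have h2 : (b.degree : ZMod 2) = e' := hg hb
  simp [map_add, h1, h2]

theorem pderiv_mem_parityPoly {e : ZMod 2} {f : MvPolynomial (Fin 3) ℝ} (i : Fin 3)
    (hf : f ∈ parityPoly (e + 1)) : pderiv i f ∈ parityPoly e := by
  rw [parityPoly, restrictSupport_eq_span] at hf
  induction hf using Submodule.span_induction with
  | mem f hf =>
    obtain ⟨d, hd, rfl⟩ := hf
    have hd' : (d.degree : ZMod 2) = e + 1 := hd
    dsimp only
    rw [pderiv_monomial, parityPoly, monomial_mem_restrictSupport]
    by_cases h0 : d i = 0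
    · right; simp [h0]
    · left
      have hle : Finsupp.single i 1 ≤ d := by
        rw [Finsupp.single_le_iff]; omega
      have h := congrArg Finsupp.degree (tsub_add_cancel_of_le hle)
      rw [map_add, Finsupp.degree_single] at h
      rw [← h, Nat.cast_add, Nat.cast_one] at hd'
      exact add_right_cancel hd'
  | zero => rw [map_zero]; exact Submodule.zero_mem _
  | add x y _ _ hx hy => rw [map_add]; exact Submodule.add_mem _ hx hy
  | smul c x _ hx => rw [Derivation.map_smul]; exact Submodule.smul_mem _ c hx

theorem polyBracket_mem_parityPoly {f g : MvPolynomial (Fin 3) ℝ} (hf : f ∈ parityPoly 1)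
    (hg : g ∈ parityPoly 1) : polyBracket f g ∈ parityPoly 1 := by
  have hd : ∀ {f}, f ∈ parityPoly 1 → ∀ i, pderiv i f ∈ parityPoly 0 := fun h i =>
    pderiv_mem_parityPoly i (by rwa [zero_add])
  have hm : ∀ i j k, X i * (pderiv j f * pderiv k g - pderiv k f * pderiv j g) ∈ parityPoly 1 := by
    intro i j k
    have h2 : ∀ j k, pderiv j f * pderiv k g ∈ parityPoly 0 := fun j k => by
      simpa using mul_mem_parityPoly (hd hf j) (hd hg k)
    simpa using mul_mem_parityPoly (X_mem_parityPoly i) (Submodule.sub_mem _ (h2 j k) (h2 k j))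
  exact Submodule.add_mem _ (Submodule.add_mem _ (hm _ _ _) (hm _ _ _)) (hm _ _ _)

/-- `Õ = 𝒪 ⊕ ℝ`: the odd polynomials together with the constants. -/
def oddPolyConst (s : ℝ) : PoissonSubalgebra s where
  toSubmodule := oddPoly s ⊔ Submodule.span ℝ {1}
  poisson_mem := by
    have hspan : oddPoly s ⊔ Submodule.span ℝ {1} =
        Submodule.span ℝ ((oddPoly s : Set (SpherePoly s)) ∪ {1}) := by
      rw [Submodule.span_union, Submodule.span_eq]
    intro a b ha hb
    rw [hspan] at ha hb
    refine poisson_mem_of_span ?_ ha hb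
    rintro a (⟨f, hf, rfl⟩ | rfl) b (⟨g, hg, rfl⟩ | rfl)
    · refine Submodule.mem_sup_left ⟨_, ?_, (poisson_toSphere f g).symm⟩
      rw [← parityPoly_one] at hf hg ⊢
      exact polyBracket_mem_parityPoly hf hg
    · rw [poisson_one_right]; exact Submodule.zero_mem _
    · rw [poisson_one_left]; exact Submodule.zero_mem _
    · rw [poisson_one_left]; exact Submodule.zero_mem _

theorem linearPoly_le_oddPolyConst (s : ℝ) :
    (linearPoly s).toSubmodule ≤ (oddPolyConst s).toSubmodule := by
  refine Submodule.span_le.2 ?_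
  rintro a (rfl | ⟨i, rfl⟩)
  · exact Submodule.mem_sup_right (Submodule.mem_span_singleton_self _)
  · refine Submodule.mem_sup_left ⟨X i, ?_, rfl⟩
    rw [← parityPoly_one]
    exact X_mem_parityPoly i

/-! ### Operators on a dense domain of a Hilbert space -/

section Operators

variable {H : Type*} [NormedAddCommGroup H] [InnerProductSpace ℂ H] [CompleteSpace H]

/-- A linear map of a subspace `D` into itself, seen as an operator of `H` with domain `D`. -/
def toOperator {D : Submodule ℂ H} (A : Module.End ℂ D) : H →ₗ.[ℂ] H :=
  ⟨D, D.subtype ∘ₗ A⟩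

/-- An operator is essentially self-adjoint if it is closable and its closure is self-adjoint. -/
def IsEssentiallySelfAdjoint (A : H →ₗ.[ℂ] H) : Prop :=
  A.IsClosable ∧ IsSelfAdjoint A.closure

/-- The orthogonal projection `P` onto `K` commutes with the closure `Ā` of `A`, that is,
`P Ā ⊆ Ā P`; this is how a closed subspace is invariant under a self-adjoint operator `Ā`. When
`A` is self-adjoint and defined on all of `H`, it says that `A` maps `K` into `K`. -/
def Reduces (K : Submodule ℂ H) [K.HasOrthogonalProjection] (A : H →ₗ.[ℂ] H) : Prop :=
  ∀ p ∈ A.closure.graph, (K.starProjection p.1, K.starProjection p.2) ∈ A.closure.graph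

end Operators

/-! ### Quantizations -/

/-- A quantization of a Poisson subalgebra `𝒞` on the Hilbert space `H`: a real-linear map from
`𝒞` to essentially self-adjoint operators on a common invariant dense domain (all of `H` for
bounded operators), with `Q {f, g} = -i [Q f, Q g]`, and with `Q 1 = I` if `1 ∈ 𝒞`. -/
structure Quantization {s : ℝ} (𝒞 : PoissonSubalgebra s) (H : Type*) [NormedAddCommGroup H]
    [InnerProductSpace ℂ H] [CompleteSpace H] where
  /-- The common invariant domain. -/
  domain : Submodule ℂ H
  dense_domain : Dense (domain : Set H)
  /-- The operator of an observable. -/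
  op : 𝒞.toSubmodule →ₗ[ℝ] Module.End ℂ domain
  essentiallySelfAdjoint : ∀ f, IsEssentiallySelfAdjoint (toOperator (op f))
  op_poisson : ∀ f g : 𝒞.toSubmodule,
    op ⟨poisson (f : SpherePoly s) g, 𝒞.poisson_mem f.2 g.2⟩ =
      (-Complex.I) • (op f * op g - op g * op f)
  op_one : ∀ h : (1 : SpherePoly s) ∈ 𝒞.toSubmodule, op ⟨1, h⟩ = 1

namespace Quantization

variable {s : ℝ} {𝒞 : PoissonSubalgebra s} {H : Type*} [NormedAddCommGroup H]
  [InnerProductSpace ℂ H] [CompleteSpace H]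

/-- The operators of the observables in `ℬ ⊆ 𝒞` act irreducibly: `H ≠ 0`, and no closed subspace
other than `0` and `H` is invariant under all of them. -/
def IsIrreducibleOn (Q : Quantization 𝒞 H) (ℬ : PoissonSubalgebra s)
    (hℬ : ℬ.toSubmodule ≤ 𝒞.toSubmodule) : Prop :=
  Nontrivial H ∧ ∀ (K : Submodule ℂ H) [K.HasOrthogonalProjection],
    (∀ (b : SpherePoly s) (hb : b ∈ ℬ.toSubmodule), Reduces K (toOperator (Q.op ⟨b, hℬ hb⟩))) →
      K = ⊥ ∨ K = ⊤

/-- The operator of `S_i`, when `𝒫¹ ⊆ 𝒞`. -/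
def spinOp (Q : Quantization 𝒞 H) (h𝒞 : (linearPoly s).toSubmodule ≤ 𝒞.toSubmodule)
    (i : Fin 3) : Module.End ℂ Q.domain :=
  Q.op ⟨spin s i, h𝒞 (Submodule.subset_span (Or.inr ⟨i, rfl⟩))⟩

/-- Nelson's condition for the representation of `su(2)` by the `S_i` to be the differential of a
continuous unitary representation of `SU(2)`: the sum of squares of the three operators is
essentially self-adjoint. It holds automatically for bounded operators (with domain `H`). -/
def IsIntegrable (Q : Quantization 𝒞 H)
    (h𝒞 : (linearPoly s).toSubmodule ≤ 𝒞.toSubmodule) : Prop :=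
  IsEssentiallySelfAdjoint (toOperator (∑ i, Q.spinOp h𝒞 i ^ 2))

/-- An admissible quantization of `(𝒞, 𝒫¹)`: one for which `𝒫¹` is represented irreducibly (and
integrably, a condition which is void for bounded operators). -/
structure IsAdmissible (Q : Quantization 𝒞 H)
    (h𝒞 : (linearPoly s).toSubmodule ≤ 𝒞.toSubmodule) : Prop where
  irreducible : Q.IsIrreducibleOn (linearPoly s) h𝒞
  integrable : Q.IsIntegrable h𝒞

/-- The quantization is trivial if it restricts to the spin `0` representation of `𝒫¹`: the
Hilbert space is one-dimensional and the `S_i` are represented by `0`. -/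
def IsTrivial (Q : Quantization 𝒞 H)
    (h𝒞 : (linearPoly s).toSubmodule ≤ 𝒞.toSubmodule) : Prop :=
  Module.finrank ℂ H = 1 ∧ ∀ i, Q.spinOp h𝒞 i = 0

end Quantization

end SphereQuantization

end

noncomputable section

namespace SphereQuantization

/-! ### The real and imaginary parts of `(S_1 + i S_2)^n` -/

/-! The kernel of a quantization is stable under brackets, and it is shown to contain `S_3`. Write
`A_i` for the operator of `S_i` and `C` for the sum of their squares.

The operator `C` is nonnegative and commutes with the `A_i`, which are bounded relative to `C`. Its
resolvent therefore commutes with the closures of all operators of `𝒫¹`, and Schur's lemma makes `C`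
a scalar (`exists_casimir_eq_smul_one`). So the `A_i` are bounded. The raising operator `A_0 + i
A_1` is then nilpotent, and the identity `(A_0 - i A_1)(A_0 + i A_1) = c - A_2 - A_2²` makes `A_2`
algebraic (`exists_aeval_spin_eq_zero`). Hence `ad A_2` has no eigenvalue of large modulus.

Bracketing with `S_3` rotates `(S_1 + i S_2)^n` with weight `n`, so for large odd `n` its real and
imaginary parts are quantized by `0`. Their bracket is `n² S_3 (S_1² + S_2²)^(n-1)`, which puts a
zonal polynomial in the kernel (`exists_zonal_mem_ker`). Repeated brackets, together with the
relation of the sphere, lower its degree down to `S_3` itself (`X_two_mem_of_zonal_mem`). The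
commutation relations then kill every `A_i`, and irreducibility leaves only a one-dimensional `H`.
-/

/-- The real and the imaginary part of `(S_1 + i S_2) ^ n`. -/
def circularPow : ℕ → MvPolynomial (Fin 3) ℝ × MvPolynomial (Fin 3) ℝ
  | 0 => (1, 0)
  | n + 1 => (X 0 * (circularPow n).1 - X 1 * (circularPow n).2,
      X 0 * (circularPow n).2 + X 1 * (circularPow n).1)

theorem circularPow_norm (n : ℕ) :
    (circularPow n).1 ^ 2 + (circularPow n).2 ^ 2 = (X 0 ^ 2 + X 1 ^ 2) ^ n := by
  induction n with
  | zero => simp [circularPow]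
  | succ n ih => rw [pow_succ (X 0 ^ 2 + X 1 ^ 2), ← ih]; simp only [circularPow]; ring

theorem circularPow_mem_parityPoly (n : ℕ) :
    (circularPow n).1 ∈ parityPoly n ∧ (circularPow n).2 ∈ parityPoly n := by
  induction n with
  | zero =>
    refine ⟨?_, Submodule.zero_mem _⟩
    have : (1 : MvPolynomial (Fin 3) ℝ) = monomial 0 1 := rfl
    simp only [circularPow]
    rw [this, parityPoly, monomial_mem_restrictSupport]
    left
    simp
  | succ n ih =>
    have h : ∀ i, ∀ f ∈ parityPoly n, X i * f ∈ parityPoly ((n + 1 : ℕ) : ZMod 2) := by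
      intro i f hf
      rw [Nat.cast_succ, add_comm]
      exact mul_mem_parityPoly (X_mem_parityPoly i) hf
    exact ⟨Submodule.sub_mem _ (h 0 _ ih.1) (h 1 _ ih.2),
      Submodule.add_mem _ (h 0 _ ih.2) (h 1 _ ih.1)⟩

/-- With `w = S_1 + i S_2`, this and the next lemma are the real form of `∂₁ wⁿ⁺¹ = (n+1) wⁿ` and
`∂₂ wⁿ⁺¹ = i (n+1) wⁿ`. -/
theorem pderiv_zero_circularPow (n : ℕ) :
    pderiv 0 (circularPow (n + 1)).1 = (n + 1) * (circularPow n).1 ∧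
      pderiv 0 (circularPow (n + 1)).2 = (n + 1) * (circularPow n).2 := by
  induction n with
  | zero => simp [circularPow, pderiv_X]
  | succ n ih =>
    rw [circularPow]
    simp only [map_sub, map_add, Derivation.leibniz, ih.1, ih.2, pderiv_X, smul_eq_mul]
    constructor <;> simp [circularPow] <;> ring

theorem pderiv_one_circularPow (n : ℕ) :
    pderiv 1 (circularPow (n + 1)).1 = -((n + 1) * (circularPow n).2) ∧
      pderiv 1 (circularPow (n + 1)).2 = (n + 1) * (circularPow n).1 := by
  induction n with
  | zero => simp [circularPow, pderiv_X]
  | succ n ih =>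
    rw [circularPow]
    simp only [map_sub, map_add, Derivation.leibniz, ih.1, ih.2, pderiv_X, smul_eq_mul]
    constructor <;> simp [circularPow] <;> ring

theorem pderiv_two_circularPow (n : ℕ) :
    pderiv 2 (circularPow n).1 = 0 ∧ pderiv 2 (circularPow n).2 = 0 := by
  induction n with
  | zero => simp [circularPow]
  | succ n ih =>
    simp only [circularPow, map_sub, map_add, Derivation.leibniz, ih.1, ih.2, pderiv_X,
      smul_eq_mul]
    simp

/-- `S_3` generates the rotations about the third axis, under which `w^(n+1)` has weight `n + 1`. -/
theorem polyBracket_X_two_circularPow (n : ℕ) :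
    polyBracket (X 2) (circularPow (n + 1)).1 = (n + 1 : ℝ) • (circularPow (n + 1)).2 ∧
      polyBracket (X 2) (circularPow (n + 1)).2 = -((n + 1 : ℝ) • (circularPow (n + 1)).1) := by
  obtain ⟨h1, h2⟩ := pderiv_zero_circularPow n
  obtain ⟨h3, h4⟩ := pderiv_one_circularPow n
  simp only [polyBracket, h1, h2, h3, h4, pderiv_two_circularPow, pderiv_X, smul_eq_C_mul]
  constructor <;> simp [circularPow] <;> ring

/-- Neither part depends on `S_3`, so the bracket is `S_3` times the Jacobian of the holomorphic map
`w ↦ w^(n+1)`, that is `|(n+1) wⁿ|²`. -/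
theorem polyBracket_circularPow (n : ℕ) :
    polyBracket (circularPow (n + 1)).1 (circularPow (n + 1)).2 =
      ((n + 1 : ℝ) ^ 2) • (X 2 * (X 0 ^ 2 + X 1 ^ 2) ^ n) := by
  obtain ⟨h1, h2⟩ := pderiv_zero_circularPow n
  obtain ⟨h3, h4⟩ := pderiv_one_circularPow n
  rw [← circularPow_norm]
  simp only [polyBracket, h1, h2, h3, h4, pderiv_two_circularPow, smul_eq_C_mul]
  simp
  ring

/-! ### Descent by the quadratic Casimir element -/

/-- The missing double bracket with `X 2` vanishes by rotational symmetry, so the left side is the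
full quadratic Casimir. The term in `S_3³` is what allows the exponent to drop on the sphere. -/
theorem casimir_zonal (m : ℕ) :
    polyBracket (polyBracket (X 2 * (X 0 ^ 2 + X 1 ^ 2) ^ (m + 1)) (X 0)) (X 0) +
      polyBracket (polyBracket (X 2 * (X 0 ^ 2 + X 1 ^ 2) ^ (m + 1)) (X 1)) (X 1) =
    4 * ((m : MvPolynomial (Fin 3) ℝ) + 1) ^ 2 * (X 2 ^ 3 * (X 0 ^ 2 + X 1 ^ 2) ^ m) -
      (6 * (m : MvPolynomial (Fin 3) ℝ) + 8) * (X 2 * (X 0 ^ 2 + X 1 ^ 2) ^ (m + 1)) := by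
  have h0 : polyBracket (X 2 * (X 0 ^ 2 + X 1 ^ 2) ^ (m + 1)) (X 0) =
      X 1 * (X 0 ^ 2 + X 1 ^ 2) ^ (m + 1) -
        2 * ((m : MvPolynomial (Fin 3) ℝ) + 1) * (X 1 * X 2 ^ 2 * (X 0 ^ 2 + X 1 ^ 2) ^ m) := by
    simp [polyBracket, pderiv_X, Derivation.leibniz_pow]
    ring
  have h1 : polyBracket (X 2 * (X 0 ^ 2 + X 1 ^ 2) ^ (m + 1)) (X 1) =
      -(X 0 * (X 0 ^ 2 + X 1 ^ 2) ^ (m + 1)) +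
        2 * ((m : MvPolynomial (Fin 3) ℝ) + 1) * (X 0 * X 2 ^ 2 * (X 0 ^ 2 + X 1 ^ 2) ^ m) := by
    simp [polyBracket, pderiv_X, Derivation.leibniz_pow]
    ring
  have h2 : ∀ i, pderiv i (2 : MvPolynomial (Fin 3) ℝ) = 0 := fun i =>
    (pderiv i).map_natCast 2
  rw [h0, h1]
  -- Differentiating the `m`-th power produces the truncated exponent `m - 1`, so `m = 0` is
  -- separate.
  rcases m with _ | m
  · simp [polyBracket, pderiv_X, Derivation.leibniz_pow, h2]
    ring
  · simp [polyBracket, pderiv_X, Derivation.leibniz_pow, h2]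
    ring

theorem zonal_mem_parityPoly (m : ℕ) : X 2 * (X 0 ^ 2 + X 1 ^ 2) ^ m ∈ parityPoly 1 := by
  have hsq : ∀ i, (X i : MvPolynomial (Fin 3) ℝ) ^ 2 ∈ parityPoly 0 := fun i => by
    have := mul_mem_parityPoly (X_mem_parityPoly i) (X_mem_parityPoly i)
    rwa [← pow_two, show (1 : ZMod 2) + 1 = 0 from by decide] at this
  induction m with
  | zero => simpa using X_mem_parityPoly 2
  | succ m ih =>
    rw [pow_succ, ← mul_assoc]
    simpa using mul_mem_parityPoly ih (Submodule.add_mem _ (hsq 0) (hsq 1))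

/-- A subspace of polynomials that is stable under brackets with odd polynomials and under
congruence modulo the ideal of the sphere contains `S_3` as soon as it contains some
`S_3 (S_1² + S_2²)^m`. -/
theorem X_two_mem_of_zonal_mem {s : ℝ} (hs : s ≠ 0) {N : Submodule ℝ (MvPolynomial (Fin 3) ℝ)}
    (hbr : ∀ f ∈ N, ∀ g ∈ parityPoly 1, polyBracket f g ∈ N)
    (hcongr : ∀ f ∈ N, ∀ f' ∈ parityPoly 1, f - f' ∈ sphereIdeal s → f' ∈ N)
    {m : ℕ} (hm : X 2 * (X 0 ^ 2 + X 1 ^ 2) ^ m ∈ N) : X 2 ∈ N := by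
  induction m with
  | zero => simpa using hm
  | succ m ih =>
    apply ih
    -- On the sphere `S_3² = s² - (S_1² + S_2²)`. The coefficient below cancels every multiple of
    -- the zonal polynomial of exponent `m + 1` and leaves `4 (m+1)² s²` times the one of exponent
    -- `m`; dividing by it requires `s ≠ 0`.
    have hmem := N.add_mem (N.add_mem
      (hbr _ (hbr _ hm _ (X_mem_parityPoly 0)) _ (X_mem_parityPoly 0))
      (hbr _ (hbr _ hm _ (X_mem_parityPoly 1)) _ (X_mem_parityPoly 1)))
      (N.smul_mem (6 * m + 8 + 4 * (m + 1) ^ 2 : ℝ) hm)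
    rw [casimir_zonal] at hmem
    have hc : (4 * (m + 1) ^ 2 * s ^ 2 : ℝ) ≠ 0 := by positivity
    rw [← inv_smul_smul₀ hc (X 2 * (X 0 ^ 2 + X 1 ^ 2) ^ m : MvPolynomial (Fin 3) ℝ)]
    refine N.smul_mem _ (hcongr _ hmem _ (Submodule.smul_mem _ _ (zonal_mem_parityPoly m)) ?_)
    rw [sphereIdeal, Ideal.mem_span_singleton']
    refine ⟨4 * ((m : MvPolynomial (Fin 3) ℝ) + 1) ^ 2 * (X 2 * (X 0 ^ 2 + X 1 ^ 2) ^ m), ?_⟩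
    simp only [smul_eq_C_mul, map_add, map_mul, map_pow, map_natCast, map_one, map_ofNat]
    ring

/-! ### Ladder operators -/

section Ladder

variable {E : Type*} [Ring E] [Algebra ℂ E]

theorem aeval_mul_of_commutator {A B : E} {c : ℂ} (h : A * B - B * A = c • B)
    (p : Polynomial ℂ) :
    Polynomial.aeval A p * B =
      B * Polynomial.aeval A (p.comp (Polynomial.X + Polynomial.C c)) := by
  have hAB : A * B = B * (A + algebraMap ℂ E c) := by
    rw [mul_add, ← Algebra.commutes, ← Algebra.smul_def, ← h]; abel
  rw [Polynomial.aeval_comp]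
  simp only [map_add, Polynomial.aeval_X, Polynomial.aeval_C]
  induction p using Polynomial.induction_on with
  | C a => simp only [Polynomial.aeval_C]; exact Algebra.commutes _ _
  | add p q hp hq => rw [map_add, map_add, add_mul, mul_add, hp, hq]
  | monomial n a ih =>
    rw [pow_succ, ← mul_assoc, map_mul _ _ Polynomial.X, map_mul _ _ Polynomial.X,
      Polynomial.aeval_X, Polynomial.aeval_X, mul_assoc, hAB, ← mul_assoc, ih, mul_assoc]

/-- If `A` is algebraic, then `ad A` has no eigenvalues of large modulus. -/
theorem exists_bound_of_commutator {A : E} {q : Polynomial ℂ} (hq : q ≠ 0)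
    (hA : Polynomial.aeval A q = 0) :
    ∃ N : ℝ, ∀ c : ℂ, N < ‖c‖ → ∀ B : E, A * B - B * A = c • B → B = 0 := by
  obtain ⟨R, hR⟩ : ∃ R : ℝ, ∀ z : ℂ, q.IsRoot z → ‖z‖ ≤ R := by
    refine ⟨∑ z ∈ q.roots.toFinset, ‖z‖, fun z hz => ?_⟩
    exact Finset.single_le_sum (f := fun z : ℂ => ‖z‖) (fun _ _ => norm_nonneg _)
      (Multiset.mem_toFinset.2 ((Polynomial.mem_roots hq).2 hz))
  -- A common root `z` of `q` and its translate makes `z` and `z + c` both roots of `q`, whence `‖c‖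
  -- ≤ 2R`.
  refine ⟨R + R, fun c hc B hB => ?_⟩
  have hcop : IsCoprime q (q.comp (Polynomial.X + Polynomial.C c)) := by
    rw [Polynomial.isCoprime_iff_aeval_ne_zero_of_isAlgClosed ℂ ℂ]
    intro z
    by_contra! hz
    have h1 := hR z (by simpa using hz.1)
    have h2 := hR (z + c) (by simpa [Polynomial.aeval_comp] using hz.2)
    have h3 : ‖c‖ ≤ ‖z + c‖ + ‖z‖ := by simpa using norm_sub_le (z + c) z
    linarith
  obtain ⟨u, v, huv⟩ := hcop
  have h1 := congrArg (Polynomial.aeval A) huv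
  rw [map_add, map_mul, map_mul, hA, mul_zero, zero_add, map_one, ← map_mul, mul_comm v,
    map_mul] at h1
  -- `q(A + c)` is invertible by Bézout, while `B q(A + c) = q(A) B = 0`.
  calc B = B * 1 := (mul_one B).symm
    _ = 0 := by rw [← h1, ← mul_assoc, ← aeval_mul_of_commutator hB, hA, zero_mul, zero_mul]

theorem commutator_pow {A B : E} {c : ℂ} (h : A * B - B * A = c • B) (n : ℕ) :
    A * B ^ n - B ^ n * A = (n * c) • B ^ n := by
  induction n with
  | zero => simp
  | succ n ih =>
    have : A * B ^ (n + 1) - B ^ (n + 1) * A =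
        (A * B ^ n - B ^ n * A) * B + B ^ n * (A * B - B * A) := by
      rw [pow_succ]; noncomm_ring
    rw [this, ih, h, smul_mul_assoc, mul_smul_comm, ← pow_succ, ← add_smul]
    push_cast
    ring_nf

/-- The inner factor `M P = g(A)` is moved to the right across `Pⁿ`, which shifts its argument by
`n`. -/
theorem pow_mul_pow_eq_aeval {A P M : E} {g : Polynomial ℂ} (h : A * P - P * A = P)
    (hMP : M * P = Polynomial.aeval A g) (n : ℕ) :
    M ^ n * P ^ n = Polynomial.aeval A
      (∏ i ∈ Finset.range n, g.comp (Polynomial.X + Polynomial.C (i : ℂ))) := by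
  induction n with
  | zero => simp
  | succ n ih =>
    have hn := commutator_pow (A := A) (B := P) (c := 1) (by simpa using h) n
    rw [mul_one] at hn
    rw [Finset.prod_range_succ, map_mul, ← ih, pow_succ, pow_succ', mul_assoc, ← mul_assoc M,
      hMP, aeval_mul_of_commutator hn, mul_assoc]

/-- The annihilating polynomial is the product of the shifts of `g`; the degree hypothesis keeps
each factor nonzero. -/
theorem exists_aeval_eq_zero_of_ladder {A P M : E} {g : Polynomial ℂ} (hg : 0 < g.natDegree)
    (h : A * P - P * A = P) (hMP : M * P = Polynomial.aeval A g) {n : ℕ} (hn : P ^ n = 0) :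
    ∃ q : Polynomial ℂ, q ≠ 0 ∧ Polynomial.aeval A q = 0 := by
  refine ⟨_, ?_, by rw [← pow_mul_pow_eq_aeval h hMP n, hn, mul_zero]⟩
  refine Finset.prod_ne_zero_iff.2 fun i _ h0 => ?_
  have := congrArg Polynomial.natDegree h0
  rw [Polynomial.natDegree_comp, Polynomial.natDegree_X_add_C, Polynomial.natDegree_zero] at this
  omega

end Ladder

/-- `ad A` has norm at most `2‖A‖`, but `Pⁿ` would be an eigenvector for the eigenvalue `n`. -/
theorem exists_pow_eq_zero_of_commutator {E : Type*} [NormedRing E] [NormedAlgebra ℂ E]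
    {A P : E} (h : A * P - P * A = P) : ∃ n : ℕ, P ^ n = 0 := by
  obtain ⟨n, hn⟩ := exists_nat_gt (2 * ‖A‖)
  refine ⟨n, ?_⟩
  by_contra hP
  have h1 := commutator_pow (A := A) (B := P) (c := 1) (by simpa using h) n
  have h2 : ‖((n : ℂ) * 1) • P ^ n‖ = n * ‖P ^ n‖ := by rw [norm_smul]; simp
  have h3 : ‖A * P ^ n - P ^ n * A‖ ≤ 2 * ‖A‖ * ‖P ^ n‖ :=
    (norm_sub_le _ _).trans (by linarith [norm_mul_le A (P ^ n), norm_mul_le (P ^ n) A])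
  rw [h1, h2] at h3
  exact absurd (le_of_mul_le_mul_right h3 (norm_pos_iff.2 hP)) (not_le.2 hn)

/-- In a representation of `su(2)` by bounded operators on a (possibly incomplete) normed space
in which the Casimir operator is a scalar, every component of the spin is algebraic. -/
theorem exists_aeval_spin_eq_zero {D : Type*} [NormedAddCommGroup D] [NormedSpace ℂ D]
    {A : Fin 3 → Module.End ℂ D} (hbd : ∀ i, ∃ K, ∀ v, ‖A i v‖ ≤ K * ‖v‖)
    (h12 : A 1 * A 2 - A 2 * A 1 = Complex.I • A 0)
    (h20 : A 2 * A 0 - A 0 * A 2 = Complex.I • A 1)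
    (h01 : A 0 * A 1 - A 1 * A 0 = Complex.I • A 2)
    {c : ℂ} (hc : A 0 ^ 2 + A 1 ^ 2 + A 2 ^ 2 = c • 1) :
    ∃ q : Polynomial ℂ, q ≠ 0 ∧ Polynomial.aeval (A 2) q = 0 := by
  set P := A 0 + Complex.I • A 1 with hP
  have hAP : A 2 * P - P * A 2 = P := by
    have : A 2 * P - P * A 2 = (A 2 * A 0 - A 0 * A 2) - Complex.I • (A 1 * A 2 - A 2 * A 1) := by
      rw [hP, mul_add, add_mul, mul_smul_comm, smul_mul_assoc, smul_sub]; abel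
    rw [this, h20, h12, smul_smul, Complex.I_mul_I, neg_one_smul, hP]
    abel
  have hMP : (A 0 - Complex.I • A 1) * P =
      Polynomial.aeval (A 2) (Polynomial.C c - Polynomial.X - Polynomial.X ^ 2) := by
    have : (A 0 - Complex.I • A 1) * P =
        A 0 ^ 2 + A 1 ^ 2 + Complex.I • (A 0 * A 1 - A 1 * A 0) := by
      rw [hP, sub_mul, mul_add, mul_add, mul_smul_comm, smul_mul_assoc, smul_mul_assoc,
        mul_smul_comm, smul_smul, Complex.I_mul_I, neg_one_smul, smul_sub, pow_two, pow_two]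
      abel
    rw [this, h01, smul_smul, Complex.I_mul_I, neg_one_smul, eq_sub_of_add_eq hc]
    simp only [map_sub, Polynomial.aeval_C, Polynomial.aeval_X, map_pow,
      Algebra.algebraMap_eq_smul_one]
    abel
  have hg : 0 < (Polynomial.C c - Polynomial.X - Polynomial.X ^ 2).natDegree := by
    have : (Polynomial.C c - Polynomial.X - Polynomial.X ^ 2).natDegree = 2 := by
      compute_degree!
    omega
  choose K hK using hbd
  let a : Fin 3 → D →L[ℂ] D := fun i => (A i).mkContinuous (K i) (hK i)
  have hpow : ∀ (T : D →L[ℂ] D) (n : ℕ), ((T ^ n : D →L[ℂ] D) : D →ₗ[ℂ] D) =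
      (T : Module.End ℂ D) ^ n := fun T n => map_pow ContinuousLinearMap.toLinearMapRingHom T n
  -- Boundedness enters only here: nilpotency is obtained in the normed ring of bounded operators
  -- and carried back to `Module.End`.
  obtain ⟨n, hn⟩ := exists_pow_eq_zero_of_commutator (E := D →L[ℂ] D)
    (A := a 2) (P := a 0 + Complex.I • a 1) (by
      ext v
      exact LinearMap.congr_fun hAP v)
  refine exists_aeval_eq_zero_of_ladder hg hAP hMP (n := n) ?_
  have h := hpow (a 0 + Complex.I • a 1) n
  rw [hn] at h
  exact h.symm

/-! ### Schur's lemma for families of closed operators -/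

section Schur

variable {H : Type*} [NormedAddCommGroup H] [InnerProductSpace ℂ H]

/-- The bounded operator `T` commutes with the operator of graph `G`. -/
def Preserves (G : Submodule ℂ (H × H)) (T : H →L[ℂ] H) : Prop :=
  ∀ p ∈ G, (T p.1, T p.2) ∈ G

theorem isClosed_setOf_preserves {G : Submodule ℂ (H × H)} (hG : IsClosed (G : Set (H × H))) :
    IsClosed {T : H →L[ℂ] H | Preserves G T} := by
  simp only [Preserves, Set.ofPred_forall]
  refine isClosed_iInter fun p => isClosed_iInter fun _ => hG.preimage ?_
  fun_prop

theorem Preserves.pow {G : Submodule ℂ (H × H)} {T : H →L[ℂ] H} (hT : Preserves G T) (n : ℕ) :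
    Preserves G (T ^ n) := by
  induction n with
  | zero => exact fun p hp => hp
  | succ n ih =>
    intro p hp
    rw [pow_succ]
    exact ih _ (hT p hp)

variable [CompleteSpace H]

theorem Preserves.cfc {G : Submodule ℂ (H × H)} (hG : IsClosed (G : Set (H × H)))
    {T : H →L[ℂ] H} (hT : Preserves G T) (hTsa : IsSelfAdjoint T) (f : ℝ → ℝ) :
    Preserves G (cfc f T) := by
  rw [cfc_def]
  split_ifs with h
  swap
  -- Outside its domain of definition `cfc` takes the value `0`.
  · exact fun p _ => G.zero_mem
  generalize (⟨_, h.2.domRestrict⟩ : C(spectrum ℝ T, ℝ)) = g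
  induction g using ContinuousMap.induction_on_of_compact with
  | const r =>
    have h1 : ContinuousMap.const (spectrum ℝ T) r = algebraMap ℝ C(spectrum ℝ T, ℝ) r := rfl
    rw [h1, AlgHomClass.commutes, Algebra.algebraMap_eq_smul_one]
    exact fun p hp => G.smul_mem (r : ℂ) hp
  | id => rw [cfcHom_id]; exact hT
  | star_id => rw [map_star, cfcHom_id, hTsa.star_eq]; exact hT
  | add f g hf hg => rw [map_add]; exact fun p hp => G.add_mem (hf p hp) (hg p hp)
  | mul f g hf hg => rw [map_mul]; exact fun p hp => hf _ (hg p hp)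
  | frequently f hf =>
    exact hf.mem_of_closed
      ((isClosed_setOf_preserves hG).preimage (cfcHom_continuous (R := ℝ) hTsa))

/-- The projection onto the fixed space of a contraction is a limit of its Cesàro means. -/
theorem Preserves.starProjection_eqLocus {G : Submodule ℂ (H × H)}
    (hG : IsClosed (G : Set (H × H))) {U : H →L[ℂ] H} (hU : Preserves G U) (hU1 : ‖U‖ ≤ 1)
    {p : H × H} (hp : p ∈ G) :
    ((U.eqLocus (1 : H →L[ℂ] H)).starProjection p.1,
      (U.eqLocus (1 : H →L[ℂ] H)).starProjection p.2) ∈ G := by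
  have h1 := U.tendsto_birkhoffAverage_orthogonalProjection hU1 p.1
  have h2 := U.tendsto_birkhoffAverage_orthogonalProjection hU1 p.2
  refine hG.mem_of_tendsto (h1.prodMk_nhds h2) (Filter.Eventually.of_forall fun n => ?_)
  have h3 : (birkhoffAverage ℂ U _root_.id n p.1, birkhoffAverage ℂ U _root_.id n p.2) =
      (n : ℂ)⁻¹ • ∑ k ∈ Finset.range n, (((U ^ k) p.1, (U ^ k) p.2) : H × H) := by
    ext <;> simp [birkhoffAverage, birkhoffSum, Prod.fst_sum, Prod.snd_sum]
  rw [SetLike.mem_coe, h3]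
  exact G.smul_mem _ (G.sum_mem fun k _ => hU.pow k p hp)

/-- Schur's lemma without spectral projections. For `a < m < b` with `a`, `b` in the spectrum, `g`
is `1` exactly on `(-∞, m]` and `h` is supported there, so `g h = h`. The fixed space of `g(R)`
contains the range of `h(R)`, nonzero since `h(a) ≠ 0`, and is proper since `g(b) ≠ 1`. As `g(R)` is
a contraction, Cesàro means show that the projection onto this space preserves the graphs. -/
theorem exists_eq_smul_one_of_irreducible [Nontrivial H] {ι : Type*}
    {G : ι → Submodule ℂ (H × H)} (hG : ∀ i, IsClosed (G i : Set (H × H)))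
    (hirr : ∀ (K : Submodule ℂ H) [K.HasOrthogonalProjection],
      (∀ i, ∀ p ∈ G i, (K.starProjection p.1, K.starProjection p.2) ∈ G i) → K = ⊥ ∨ K = ⊤)
    {R : H →L[ℂ] H} (hR : IsSelfAdjoint R) (hGR : ∀ i, Preserves (G i) R) :
    ∃ r : ℝ, R = (r : ℂ) • 1 := by
  suffices h : (spectrum ℝ R).Subsingleton by
    obtain h0 | ⟨r, hr⟩ := h.eq_empty_or_singleton
    · exact absurd h0 (ContinuousFunctionalCalculus.spectrum_nonempty R hR).ne_empty
    · refine ⟨r, ?_⟩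
      rw [CFC.eq_algebraMap_of_spectrum_subset_singleton R r hr.subset hR,
        Algebra.algebraMap_eq_smul_one]
      ext x
      simp
  have key : ∀ a ∈ spectrum ℝ R, ∀ b ∈ spectrum ℝ R, ¬ a < b := by
    intro a ha b hb hab
    obtain ⟨m, ham, hmb⟩ := exists_between hab
    let g : ℝ → ℝ := fun t => (1 + max 0 (t - m))⁻¹
    let h : ℝ → ℝ := fun t => max 0 (m - t)
    have hden : ∀ t, 0 < 1 + max 0 (t - m) := fun t => by positivity
    have hgc : Continuous g := by
      refine Continuous.inv₀ (by fun_prop) fun t => (hden t).ne'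
    have hhc : Continuous h := by fun_prop
    have hgh : ∀ t, g t * h t = h t := by
      intro t
      rcases le_total t m with ht | ht
      · simp [g, h, max_eq_left (sub_nonpos.2 ht)]
      · simp [h, max_eq_left (sub_nonpos.2 ht)]
    have hmul : cfc g R * cfc h R = cfc h R := by
      rw [← cfc_mul g h R hgc.continuousOn hhc.continuousOn]
      exact cfc_congr fun t _ => hgh t
    have hnorm : ‖cfc g R‖ ≤ 1 := by
      refine norm_cfc_le zero_le_one fun t _ => ?_
      rw [Real.norm_of_nonneg (inv_nonneg.2 (hden t).le)]
      exact inv_le_one_of_one_le₀ (le_add_of_nonneg_right (le_max_left _ _))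
    rcases hirr ((cfc g R).eqLocus (1 : H →L[ℂ] H)) (fun i p hp =>
      ((hGR i).cfc (hG i) hR g).starProjection_eqLocus (hG i) hnorm hp) with hK | hK
    · have h0 : cfc h R = 0 := by
        ext x
        have : cfc h R x ∈ (cfc g R).eqLocus (1 : H →L[ℂ] H) :=
          DFunLike.congr_fun hmul x
        rw [hK] at this
        exact this
      have := cfc_map_spectrum h R hR hhc.continuousOn
      rw [h0, spectrum.zero_eq] at this
      have h1 : h a ∈ ({0} : Set ℝ) := this ▸ Set.mem_image_of_mem h ha
      have h2 : h a ≤ 0 := (Set.mem_singleton_iff.1 h1).le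
      have h3 : m - a ≤ h a := le_max_right _ _
      linarith
    · have h0 : cfc g R = 1 := by
        ext x
        have : x ∈ (cfc g R).eqLocus (1 : H →L[ℂ] H) := hK ▸ Submodule.mem_top
        exact this
      have := cfc_map_spectrum g R hR hgc.continuousOn
      rw [h0, spectrum.one_eq] at this
      have h1 : g b ∈ ({1} : Set ℝ) := this ▸ Set.mem_image_of_mem g hb
      have h2 : (1 + max 0 (b - m))⁻¹ = 1 := h1
      rw [inv_eq_one, max_eq_right (by linarith)] at h2
      linarith
  intro a ha b hb
  exact le_antisymm (not_lt.1 (key b hb a ha)) (not_lt.1 (key a ha b hb))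

end Schur

/-! ### Resolvents of positive essentially self-adjoint operators -/

section Resolvent

variable {H : Type*} [NormedAddCommGroup H] [InnerProductSpace ℂ H] {D : Submodule ℂ H}

local notation "⟪" x ", " y "⟫" => inner ℂ x y

theorem mem_graph_closure (A : Module.End ℂ D) (v : D) :
    ((v : H), (A v : H)) ∈ (toOperator A).closure.graph :=
  LinearPMap.le_graph_of_le (toOperator A).le_closure
    (LinearPMap.mem_graph (toOperator A) v)

/-- A closed relation that holds on the graph of `A` holds on the graph of its closure. -/
theorem graph_closure_subset {A : Module.End ℂ D} (hA : (toOperator A).IsClosable)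
    {S : Set (H × H)} (hS : IsClosed S) (h : ∀ v : D, ((v : H), (A v : H)) ∈ S) :
    ((toOperator A).closure.graph : Set (H × H)) ⊆ S := by
  rw [← hA.graph_closure_eq_closure_graph, Submodule.topologicalClosure_coe]
  refine closure_minimal ?_ hS
  rintro ⟨x, y⟩ hxy
  obtain ⟨v, hv, hv'⟩ := (LinearPMap.mem_graph_iff _).1 hxy
  obtain rfl : x = v := hv.symm
  obtain rfl : y = A v := hv'.symm
  exact h v

theorem norm_le_norm_add_of_nonneg {C : Module.End ℂ D}
    (hpos : ∀ v, 0 ≤ (⟪v, C v⟫).re) (v : D) : ‖v‖ ≤ ‖C v + v‖ := by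
  have h1 : (⟪v, C v + v⟫).re ≤ ‖v‖ * ‖C v + v‖ :=
    (Complex.re_le_norm _).trans (norm_inner_le_norm _ _)
  have h2 : (⟪v, v⟫).re = ‖v‖ ^ 2 := by
    rw [inner_self_eq_norm_sq_to_K]; norm_cast
  rw [inner_add_right, Complex.add_re, h2] at h1
  rcases (norm_nonneg v).eq_or_lt with h0 | h0
  · rw [← h0]; positivity
  · exact le_of_mul_le_mul_left (by nlinarith [hpos v]) h0

variable [CompleteSpace H]

theorem IsEssentiallySelfAdjoint.isClosed_graph {A : Module.End ℂ D}
    (hA : IsEssentiallySelfAdjoint (toOperator A)) :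
    IsClosed ((toOperator A).closure.graph : Set (H × H)) :=
  hA.1.closure_isClosed

/-- Testing against `D` suffices to place `x` in the domain of the adjoint of the closure, which is
the closure itself. -/
theorem IsEssentiallySelfAdjoint.mem_graph {A : Module.End ℂ D}
    (hA : IsEssentiallySelfAdjoint (toOperator A)) {x y : H}
    (h : ∀ v : D, ⟪y, v⟫ = ⟪x, A v⟫) : (x, y) ∈ (toOperator A).closure.graph := by
  have hext : ∀ p ∈ (toOperator A).closure.graph, ⟪y, p.1⟫ = ⟪x, p.2⟫ :=
    fun p hp => graph_closure_subset hA.1 (S := {p | ⟪y, p.1⟫ = ⟪x, p.2⟫})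
      (isClosed_eq (by fun_prop) (by fun_prop)) h hp
  have hsa := LinearPMap.isSelfAdjoint_def.1 hA.2
  have hdom : x ∈ (toOperator A).closure.adjoint.domain :=
    LinearPMap.mem_adjoint_domain_of_exists x
      ⟨y, fun z => hext _ (LinearPMap.mem_graph _ z)⟩
  have heq := LinearPMap.adjoint_apply_eq hA.2.dense_domain ⟨x, hdom⟩
    (fun z => hext _ (LinearPMap.mem_graph _ z))
  rw [← hsa]
  exact (LinearPMap.mem_graph_iff _).2 ⟨⟨x, hdom⟩, rfl, heq⟩

theorem IsEssentiallySelfAdjoint.isSymmetric {A : Module.End ℂ D}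
    (hA : IsEssentiallySelfAdjoint (toOperator A)) : A.IsSymmetric := by
  intro v w
  have hform := LinearPMap.adjoint_isFormalAdjoint hA.2.dense_domain
  have hsa := LinearPMap.isSelfAdjoint_def.1 hA.2
  rw [hsa] at hform
  obtain ⟨v', hv, hv'⟩ := (LinearPMap.mem_graph_iff _).1 (mem_graph_closure A v)
  obtain ⟨w', hw, hw'⟩ := (LinearPMap.mem_graph_iff _).1 (mem_graph_closure A w)
  have := hform v' w'
  dsimp only at hv hv' hw hw'
  rw [hv, hv', hw, hw'] at this
  exact this

/-- A vector `w` orthogonal to the range solves `C w = -w` weakly, hence in the closure, and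
positivity forces `w = 0`. -/
theorem denseRange_add_self {C : Module.End ℂ D} (hC : IsEssentiallySelfAdjoint (toOperator C))
    (hpos : ∀ v, 0 ≤ (⟪v, C v⟫).re) :
    DenseRange (D.subtype ∘ₗ (C + 1)) := by
  rw [DenseRange, ← LinearMap.coe_range, Submodule.dense_iff_topologicalClosure_eq_top,
    Submodule.topologicalClosure_eq_top_iff, Submodule.eq_bot_iff]
  intro w hw
  have hmem : (w, -w) ∈ (toOperator C).closure.graph := by
    refine hC.mem_graph fun v => ?_
    have := (Submodule.mem_orthogonal' _ _).1 hw _ (LinearMap.mem_range_self _ v)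
    simp only [LinearMap.comp_apply, LinearMap.add_apply, Module.End.one_apply, map_add,
      Submodule.subtype_apply, inner_add_right] at this
    rw [inner_neg_left]
    linear_combination -this
  have hw0 := graph_closure_subset hC.1 (S := {p | 0 ≤ (⟪p.1, p.2⟫).re})
    (isClosed_le (by fun_prop) (Complex.continuous_re.comp (by fun_prop))) hpos hmem
  simp only [Set.mem_ofPred_eq, inner_neg_right, Complex.neg_re] at hw0
  have h2 : (⟪w, w⟫).re = ‖w‖ ^ 2 := by
    rw [inner_self_eq_norm_sq_to_K]; norm_cast
  rw [h2] at hw0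
  exact norm_eq_zero.1 (by nlinarith [norm_nonneg w])

/-- The map `(C + 1) v ↦ v` is a contraction on a dense subspace; `R` is its continuous extension.
-/
theorem exists_resolvent {C : Module.End ℂ D} (hC : IsEssentiallySelfAdjoint (toOperator C))
    (hpos : ∀ v, 0 ≤ (⟪v, C v⟫).re) :
    ∃ R : H →L[ℂ] H, IsSelfAdjoint R ∧ ∀ v : D, R ((C + 1) v : D) = v := by
  have hd := denseRange_add_self hC hpos
  have hR := LinearMap.extendOfNorm_eq (f := D.subtype) hd
    ⟨1, fun v => by rw [one_mul]; exact norm_le_norm_add_of_nonneg hpos v⟩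
  refine ⟨D.subtype.extendOfNorm (D.subtype ∘ₗ (C + 1)), ?_, hR⟩
  set R := D.subtype.extendOfNorm (D.subtype ∘ₗ (C + 1)) with hRdef
  rw [ContinuousLinearMap.isSelfAdjoint_iff_isSymmetric]
  intro x y
  refine hd.induction_on₂ (p := fun x y => ⟪R x, y⟫ = ⟪x, R y⟫)
    (isClosed_eq (by fun_prop) (by fun_prop)) (fun v w => ?_) x y
  rw [hR, hR]
  have := hC.isSymmetric v w
  simp only [LinearMap.comp_apply, LinearMap.add_apply, Module.End.one_apply, map_add,
      inner_add_right, inner_add_left]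
  exact congrArg (· + _) this.symm

/-- The resolvent of `C` commutes with the closure of a symmetric operator that commutes with
`C` and is bounded relatively to `C`. -/
theorem preserves_resolvent {C : Module.End ℂ D}
    (hC : IsEssentiallySelfAdjoint (toOperator C)) (hpos : ∀ v, 0 ≤ (⟪v, C v⟫).re)
    {R : H →L[ℂ] H} (hRsa : IsSelfAdjoint R) (hR : ∀ v : D, R ((C + 1) v : D) = v)
    {B : Module.End ℂ D} (hB : IsEssentiallySelfAdjoint (toOperator B)) (hBC : Commute B C)
    {K : ℝ} (hK : ∀ v, ‖B v‖ ≤ K * ‖(C + 1) v‖) :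
    Preserves (toOperator B).closure.graph R := by
  have hd := denseRange_add_self hC hpos
  -- `T` extends `B (C + 1)⁻¹`; by closedness it is the closure of `B` composed with `R`.
  set T : H →L[ℂ] H := (D.subtype ∘ₗ B).extendOfNorm (D.subtype ∘ₗ (C + 1))
  have hT : ∀ v : D, T ((C + 1) v : D) = B v := LinearMap.extendOfNorm_eq (f := D.subtype ∘ₗ B) hd
    ⟨K, hK⟩
  have hcomm : ∀ v, B ((C + 1) v) = (C + 1) (B v) := fun v =>
    LinearMap.congr_fun (hBC.add_right (Commute.one_right B)).eq v
  have hRs := (ContinuousLinearMap.isSelfAdjoint_iff_isSymmetric.1 hRsa)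
  have hgraph : ∀ x : H, (R x, T x) ∈ (toOperator B).closure.graph := by
    intro x
    refine hd.induction_on (p := fun x => (R x, T x) ∈ (toOperator B).closure.graph) x
      (hB.isClosed_graph.preimage (by fun_prop)) fun v => ?_
    have := mem_graph_closure B v
    rw [← hR, ← hT] at this
    exact this
  have hCs : (C + 1).IsSymmetric := hC.isSymmetric.add LinearMap.IsSymmetric.one
  have hinner : ∀ (x : H) (u : D), ⟪T x, ((C + 1) u : D)⟫ = ⟪x, (B u : H)⟫ := by
    intro x u
    refine hd.induction_on (p := fun x => ⟪T x, (((C + 1) u : D) : H)⟫ = ⟪x, (B u : H)⟫) x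
      (isClosed_eq (by fun_prop) (by fun_prop)) fun v => ?_
    have h1 : T ((D.subtype ∘ₗ (C + 1)) v) = B v := hT v
    have h2 : ⟪B v, (C + 1) u⟫ = ⟪(C + 1) v, B u⟫ := by
      rw [← hCs, ← hcomm, hB.isSymmetric]
    rw [h1]
    exact h2
  -- `D` need not lie in the range of `C + 1`, so the identity is tested against that dense range.
  have hTR : ∀ v : D, T v = R (B v) := by
    intro v
    refine hd.eq_of_inner_left ℂ fun u => ?_
    have h1 : ⟪T v, ((C + 1) u : D)⟫ = ⟪(v : H), (B u : H)⟫ := hinner v u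
    have h2 : ⟪R (B v), (((C + 1) u : D) : H)⟫ = ⟪(B v : H), R ((C + 1) u : D)⟫ := hRs _ _
    have h3 : ⟪B v, u⟫ = ⟪v, B u⟫ := hB.isSymmetric v u
    rw [hR] at h2
    exact h1.trans (h3.symm.trans h2.symm)
  intro p hp
  refine graph_closure_subset hB.1 (S := {p | (R p.1, R p.2) ∈ (toOperator B).closure.graph})
    (hB.isClosed_graph.preimage (by fun_prop)) (fun v => ?_) hp
  rw [Set.mem_ofPred_eq, ← hTR]
  exact hgraph v

end Resolvent

/-! ### The Casimir operator -/

theorem commute_casimir {E : Type*} [Ring E] [Algebra ℂ E] {A B C : E}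
    (hAB : A * B - B * A = Complex.I • C) (hCA : C * A - A * C = Complex.I • B) :
    Commute A (A ^ 2 + B ^ 2 + C ^ 2) := by
  have h : A * (A ^ 2 + B ^ 2 + C ^ 2) - (A ^ 2 + B ^ 2 + C ^ 2) * A =
      (A * B - B * A) * B + B * (A * B - B * A) -
        ((C * A - A * C) * C + C * (C * A - A * C)) := by
    noncomm_ring
  rw [hAB, hCA, smul_mul_assoc, smul_mul_assoc, mul_smul_comm, mul_smul_comm] at h
  exact sub_eq_zero.1 (h.trans (by abel))

/-- `F + iG` and `F - iG` are eigenvectors of `ad A` for `l` and `-l`, so both vanish. -/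
theorem eq_zero_of_rotation {E : Type*} [Ring E] [Algebra ℂ E] {A F G : E} {l : ℂ}
    (hpos : ∀ B : E, A * B - B * A = l • B → B = 0)
    (hneg : ∀ B : E, A * B - B * A = (-l) • B → B = 0)
    (hF : A * F - F * A = Complex.I • l • G) (hG : A * G - G * A = Complex.I • -(l • F)) :
    F = 0 := by
  have h1 : F + Complex.I • G = 0 := by
    refine hpos _ ?_
    rw [mul_add, add_mul, mul_smul_comm, smul_mul_assoc, add_sub_add_comm, hF, ← smul_sub, hG,
      smul_smul Complex.I Complex.I, Complex.I_mul_I, smul_add, smul_comm Complex.I l,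
      neg_one_smul, neg_neg, add_comm]
  have h2 : F - Complex.I • G = 0 := by
    refine hneg _ ?_
    rw [mul_sub, sub_mul, mul_smul_comm, smul_mul_assoc, sub_sub_sub_comm, hF, ← smul_sub, hG,
      smul_smul Complex.I Complex.I, Complex.I_mul_I, neg_one_smul, neg_neg, neg_smul, smul_sub,
      smul_comm Complex.I l, neg_sub]
  have h3 : (2 : ℂ) • F = 0 := by
    rw [two_smul]
    calc F + F = (F + Complex.I • G) + (F - Complex.I • G) := by abel
      _ = 0 := by rw [h1, h2, add_zero]
  exact (smul_eq_zero_iff_right two_ne_zero).1 h3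

theorem norm_sq_le_inner_sum_sq {D : Type*} [NormedAddCommGroup D] [InnerProductSpace ℂ D]
    {ι : Type*} [Fintype ι] {A : ι → Module.End ℂ D} (hA : ∀ i, (A i).IsSymmetric) (i : ι)
    (v : D) : ‖A i v‖ ^ 2 ≤ (inner ℂ v ((∑ i, A i ^ 2) v)).re := by
  have h : ∀ i, (inner ℂ v ((A i ^ 2) v)).re = ‖A i v‖ ^ 2 := by
    intro i
    rw [pow_two, Module.End.mul_apply, ← hA i, inner_self_eq_norm_sq_to_K]
    norm_cast
  rw [LinearMap.sum_apply, inner_sum, Complex.re_sum, Finset.sum_congr rfl fun i _ => h i]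
  exact Finset.single_le_sum (f := fun i => ‖A i v‖ ^ 2) (fun _ _ => by positivity)
    (Finset.mem_univ i)

/-! ### Quantizations of `Õ` -/

namespace Quantization

variable {s : ℝ} {H : Type*} [NormedAddCommGroup H] [InnerProductSpace ℂ H] [CompleteSpace H]

theorem toSphere_mem_oddPolyConst (s : ℝ) {f : MvPolynomial (Fin 3) ℝ} (hf : f ∈ parityPoly 1) :
    toSphere s f ∈ (oddPolyConst s).toSubmodule := by
  rw [parityPoly_one] at hf
  exact Submodule.mem_sup_left ⟨f, hf, rfl⟩

/-- The operator of the class of an odd polynomial. -/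
def oddOp (Q : Quantization (oddPolyConst s) H) :
    parityPoly 1 →ₗ[ℝ] Module.End ℂ Q.domain :=
  Q.op ∘ₗ ((toSphere s).domRestrict (parityPoly 1)).codRestrict (oddPolyConst s).toSubmodule
    fun f => toSphere_mem_oddPolyConst s f.2

theorem oddOp_polyBracket (Q : Quantization (oddPolyConst s) H) (f g : parityPoly 1) :
    Q.oddOp ⟨polyBracket f g, polyBracket_mem_parityPoly f.2 g.2⟩ =
      (-Complex.I) • (Q.oddOp f * Q.oddOp g - Q.oddOp g * Q.oddOp f) :=
  Q.op_poisson ⟨_, toSphere_mem_oddPolyConst s f.2⟩ ⟨_, toSphere_mem_oddPolyConst s g.2⟩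

theorem oddOp_commutator (Q : Quantization (oddPolyConst s) H) {f g h : parityPoly 1}
    (hfg : polyBracket f g = (h : MvPolynomial (Fin 3) ℝ)) :
    Q.oddOp f * Q.oddOp g - Q.oddOp g * Q.oddOp f = Complex.I • Q.oddOp h := by
  have h1 := Q.oddOp_polyBracket f g
  have h2 : (⟨polyBracket f g, polyBracket_mem_parityPoly f.2 g.2⟩ : parityPoly 1) = h :=
    Subtype.ext hfg
  rw [h2] at h1
  rw [h1, smul_smul, mul_neg, Complex.I_mul_I, neg_neg, one_smul]

theorem oddOp_congr (Q : Quantization (oddPolyConst s) H) {f g : parityPoly 1}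
    (hfg : (f : MvPolynomial (Fin 3) ℝ) - g ∈ sphereIdeal s) : Q.oddOp f = Q.oddOp g := by
  have : toSphere s f = toSphere s g := Ideal.Quotient.eq.2 hfg
  simp only [oddOp, LinearMap.comp_apply]
  exact congrArg Q.op (Subtype.ext this)

/-- The operator of `S_i`. -/
abbrev spinA (Q : Quantization (oddPolyConst s) H) (i : Fin 3) : Module.End ℂ Q.domain :=
  Q.spinOp (linearPoly_le_oddPolyConst s) i

theorem oddOp_X (Q : Quantization (oddPolyConst s) H) (i : Fin 3) :
    Q.oddOp ⟨X i, X_mem_parityPoly i⟩ = Q.spinA i := rfl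

theorem spinA_commutator (Q : Quantization (oddPolyConst s) H) :
    Q.spinA 0 * Q.spinA 1 - Q.spinA 1 * Q.spinA 0 = Complex.I • Q.spinA 2 ∧
      Q.spinA 1 * Q.spinA 2 - Q.spinA 2 * Q.spinA 1 = Complex.I • Q.spinA 0 ∧
      Q.spinA 2 * Q.spinA 0 - Q.spinA 0 * Q.spinA 2 = Complex.I • Q.spinA 1 := by
  simp only [← oddOp_X]
  refine ⟨?_, ?_, ?_⟩ <;> refine Q.oddOp_commutator ?_ <;> simp [polyBracket, pderiv_X]

theorem isSymmetric_spinA (Q : Quantization (oddPolyConst s) H) (i : Fin 3) :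
    (Q.spinA i).IsSymmetric :=
  (Q.essentiallySelfAdjoint _).isSymmetric

/-- The sum of the squares of the operators of the `S_i`. -/
abbrev casimir (Q : Quantization (oddPolyConst s) H) : Module.End ℂ Q.domain :=
  ∑ i, Q.spinA i ^ 2

theorem casimir_eq (Q : Quantization (oddPolyConst s) H) :
    Q.casimir = Q.spinA 0 ^ 2 + Q.spinA 1 ^ 2 + Q.spinA 2 ^ 2 :=
  Fin.sum_univ_three _

theorem commute_spinA_casimir (Q : Quantization (oddPolyConst s) H) (i : Fin 3) :
    Commute (Q.spinA i) Q.casimir := by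
  obtain ⟨h01, h12, h20⟩ := Q.spinA_commutator
  rw [casimir_eq]
  fin_cases i
  · exact commute_casimir h01 h20
  · have := commute_casimir h12 h01
    rwa [show Q.spinA 1 ^ 2 + Q.spinA 2 ^ 2 + Q.spinA 0 ^ 2 =
      Q.spinA 0 ^ 2 + Q.spinA 1 ^ 2 + Q.spinA 2 ^ 2 by abel] at this
  · have := commute_casimir h20 h12
    rwa [show Q.spinA 2 ^ 2 + Q.spinA 0 ^ 2 + Q.spinA 1 ^ 2 =
      Q.spinA 0 ^ 2 + Q.spinA 1 ^ 2 + Q.spinA 2 ^ 2 by abel] at this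

theorem casimir_nonneg (Q : Quantization (oddPolyConst s) H) (v : Q.domain) :
    0 ≤ (inner ℂ v (Q.casimir v)).re :=
  (sq_nonneg _).trans (norm_sq_le_inner_sum_sq Q.isSymmetric_spinA 0 v)

/-- Used twice: as the relative bound needed for the resolvent, and as a genuine bound once the
Casimir is a scalar. -/
theorem norm_spinA_le (Q : Quantization (oddPolyConst s) H) (i : Fin 3) (v : Q.domain) :
    ‖Q.spinA i v‖ ≤ ‖(Q.casimir + 1) v‖ := by
  have h1 := norm_sq_le_inner_sum_sq Q.isSymmetric_spinA i v
  have h2 : (inner ℂ v ((Q.casimir + 1) v)).re ≤ ‖v‖ * ‖(Q.casimir + 1) v‖ :=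
    (Complex.re_le_norm _).trans (norm_inner_le_norm _ _)
  have h3 : (inner ℂ v v : ℂ).re = ‖v‖ ^ 2 := by
    rw [inner_self_eq_norm_sq_to_K]; norm_cast
  have h4 : ‖v‖ ≤ ‖(Q.casimir + 1) v‖ := norm_le_norm_add_of_nonneg Q.casimir_nonneg v
  rw [LinearMap.add_apply, Module.End.one_apply, inner_add_right, Complex.add_re, h3] at h2
  rw [LinearMap.add_apply, Module.End.one_apply] at h4 ⊢
  refine abs_le_of_sq_le_sq' ?_ (norm_nonneg _) |>.2
  nlinarith [norm_nonneg v, norm_nonneg (Q.casimir v + v)]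

theorem linearPoly_induction (Q : Quantization (oddPolyConst s) H)
    {p : Module.End ℂ Q.domain → Prop} (one : p 1) (spin : ∀ i, p (Q.spinA i))
    (add : ∀ A B, p A → p B → p (A + B)) (smul : ∀ (c : ℝ) A, p A → p (c • A))
    (b : SpherePoly s) (hb : b ∈ (linearPoly s).toSubmodule) :
    p (Q.op ⟨b, linearPoly_le_oddPolyConst s hb⟩) := by
  induction hb using Submodule.span_induction with
  | mem b hb =>
    rcases hb with rfl | ⟨i, rfl⟩
    · rw [Q.op_one]; exact one
    · exact spin i
  | zero =>
    have h0 := smul 0 1 one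
    rw [zero_smul] at h0
    have h1 := map_zero Q.op
    rw [← h1] at h0
    exact h0
  | add x y hx hy ihx ihy =>
    have h := add _ _ ihx ihy
    rw [← map_add] at h
    exact h
  | smul c x hx ih =>
    have h := smul c _ ih
    rw [← map_smul] at h
    exact h

/-- Schur's lemma is applied to the bounded resolvent rather than to the Casimir, which is not yet
known to be bounded. -/
theorem exists_casimir_eq_smul_one (Q : Quantization (oddPolyConst s) H)
    (hQ : Q.IsAdmissible (linearPoly_le_oddPolyConst s)) :
    ∃ c : ℂ, Q.casimir = c • 1 := by
  have hC : IsEssentiallySelfAdjoint (toOperator Q.casimir) := hQ.integrable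
  obtain ⟨hH, hirr⟩ := hQ.irreducible
  obtain ⟨R, hRsa, hR⟩ := exists_resolvent hC Q.casimir_nonneg
  have hpres : ∀ b : (linearPoly s).toSubmodule,
      Preserves (toOperator (Q.op ⟨b, linearPoly_le_oddPolyConst s b.2⟩)).closure.graph R := by
    rintro ⟨b, hb⟩
    obtain ⟨hcomm, K, hK⟩ := Q.linearPoly_induction
      (p := fun B => Commute B Q.casimir ∧ ∃ K : ℝ, ∀ v, ‖B v‖ ≤ K * ‖(Q.casimir + 1) v‖)
      ⟨Commute.one_left _, 1, fun v => by
        rw [one_mul]; exact norm_le_norm_add_of_nonneg Q.casimir_nonneg v⟩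
      (fun i => ⟨Q.commute_spinA_casimir i, 1, fun v => by
        rw [one_mul]; exact Q.norm_spinA_le i v⟩)
      (fun A B ⟨hA, K, hK⟩ ⟨hB, L, hL⟩ => ⟨hA.add_left hB, K + L, fun v => by
        rw [add_mul]; exact (norm_add_le _ _).trans (add_le_add (hK v) (hL v))⟩)
      (fun c A ⟨hA, K, hK⟩ => ⟨hA.smul_left c, |c| * K, fun v => by
        rw [LinearMap.smul_apply, norm_smul, mul_assoc, Real.norm_eq_abs]
        exact mul_le_mul_of_nonneg_left (hK v) (abs_nonneg c)⟩)
      b hb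
    exact preserves_resolvent hC Q.casimir_nonneg hRsa hR (Q.essentiallySelfAdjoint _) hcomm hK
  obtain ⟨r, hr⟩ := exists_eq_smul_one_of_irreducible
    (G := fun b : (linearPoly s).toSubmodule =>
      (toOperator (Q.op ⟨b, linearPoly_le_oddPolyConst s b.2⟩)).closure.graph)
    (fun b => (Q.essentiallySelfAdjoint _).isClosed_graph)
    (fun K _ hK => hirr K fun b hb => hK ⟨b, hb⟩) hRsa hpres
  have hv : ∀ v, (r : ℂ) • (Q.casimir v + v) = v := fun v => by
    have := hR v
    rw [hr] at this
    exact Subtype.ext this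
  -- A zero resolvent would make the dense domain trivial.
  have hr0 : (r : ℂ) ≠ 0 := by
    intro h0
    have hbot : Q.domain = ⊥ := by
      rw [Submodule.eq_bot_iff]
      intro x hx
      have := hv ⟨x, hx⟩
      rw [h0, zero_smul] at this
      exact (congrArg Subtype.val this).symm
    have hdense := Q.dense_domain
    rw [hbot, Submodule.bot_coe, Dense, isClosed_singleton.closure_eq] at hdense
    obtain ⟨x, hx⟩ := exists_ne (0 : H)
    exact hx (hdense x)
  refine ⟨(r : ℂ)⁻¹ - 1, LinearMap.ext fun v => ?_⟩
  have h1 : Q.casimir v + v = (r : ℂ)⁻¹ • v := by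
    rw [← inv_smul_smul₀ hr0 (Q.casimir v + v), hv]
  rw [LinearMap.smul_apply, Module.End.one_apply, sub_smul, one_smul, ← h1, add_sub_cancel_right]

theorem exists_zonal_mem_ker (Q : Quantization (oddPolyConst s) H)
    (hQ : Q.IsAdmissible (linearPoly_le_oddPolyConst s)) :
    ∃ m : ℕ, Q.oddOp ⟨_, zonal_mem_parityPoly m⟩ = 0 := by
  obtain ⟨c, hc⟩ := Q.exists_casimir_eq_smul_one hQ
  obtain ⟨h01, h12, h20⟩ := Q.spinA_commutator
  have hbd : ∀ i, ∃ K : ℝ, ∀ v, ‖Q.spinA i v‖ ≤ K * ‖v‖ := by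
    refine fun i => ⟨‖c + 1‖, fun v => (Q.norm_spinA_le i v).trans_eq ?_⟩
    rw [hc, ← norm_smul, add_smul, one_smul]
    rfl
  obtain ⟨q, hq, hqA⟩ := exists_aeval_spin_eq_zero hbd h12 h20 h01 (Q.casimir_eq ▸ hc)
  obtain ⟨N, hN⟩ := exists_bound_of_commutator hq hqA
  obtain ⟨k, hk⟩ := exists_nat_gt N
  -- The exponent must be odd for the two parts to lie in `𝒪`, and must exceed the bound `N` on
  -- eigenvalues.
  have hmem := circularPow_mem_parityPoly (2 * k + 1)
  have hodd : ((2 * k + 1 : ℕ) : ZMod 2) = 1 := by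
    rw [ZMod.natCast_eq_one_iff_odd]; exact odd_two_mul_add_one k
  rw [hodd] at hmem
  set F : parityPoly 1 := ⟨_, hmem.1⟩
  set G : parityPoly 1 := ⟨_, hmem.2⟩
  let l : ℝ := ((2 * k : ℕ) : ℝ) + 1
  have hl : N < ‖(l : ℂ)‖ := by
    rw [Complex.norm_of_nonneg (by positivity)]
    refine hk.trans_le ?_
    simp only [l]
    push_cast
    linarith [(Nat.cast_nonneg k : (0 : ℝ) ≤ k)]
  obtain ⟨hb1, hb2⟩ := polyBracket_X_two_circularPow (2 * k)
  have hF := Q.oddOp_commutator (f := ⟨X 2, X_mem_parityPoly 2⟩) (g := F) (h := l • G) hb1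
  have hG := Q.oddOp_commutator (f := ⟨X 2, X_mem_parityPoly 2⟩) (g := G) (h := -(l • F)) hb2
  have hreal : ∀ (t : ℝ) (B : Module.End ℂ Q.domain), t • B = (t : ℂ) • B := fun t B =>
    LinearMap.ext fun v => (Complex.coe_smul t (B v)).symm
  rw [oddOp_X, map_smul, hreal] at hF
  rw [oddOp_X, map_neg, map_smul, hreal] at hG
  have hF0 : Q.oddOp F = 0 := eq_zero_of_rotation (hN l hl)
    (hN (-l) (by rwa [norm_neg])) hF hG
  refine ⟨2 * k, ?_⟩
  have h4 := Q.oddOp_commutator (f := F) (g := G)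
    (h := l ^ 2 • ⟨_, zonal_mem_parityPoly (2 * k)⟩) (polyBracket_circularPow (2 * k))
  rw [hF0, zero_mul, mul_zero, sub_zero, map_smul] at h4
  have hl0 : l ^ 2 ≠ 0 := by positivity
  exact (smul_eq_zero.1 ((smul_eq_zero.1 h4.symm).resolve_left Complex.I_ne_zero)).resolve_left hl0

theorem spinA_eq_zero (hs : s ≠ 0) (Q : Quantization (oddPolyConst s) H)
    (hQ : Q.IsAdmissible (linearPoly_le_oddPolyConst s)) (i : Fin 3) : Q.spinA i = 0 := by
  obtain ⟨m, hm⟩ := Q.exists_zonal_mem_ker hQ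
  have h2 : Q.spinA 2 = 0 := by
    -- The kernel is viewed among polynomials: it absorbs brackets because `Q` turns them into
    -- commutators, and congruences because `Q` is defined on classes.
    have hmem : X 2 ∈ (LinearMap.ker Q.oddOp).map (parityPoly 1).subtype := by
      refine X_two_mem_of_zonal_mem hs ?_ ?_ (m := m) ⟨_, hm, rfl⟩
      · rintro _ ⟨f, hf, rfl⟩ g hg
        have := Q.oddOp_polyBracket f ⟨g, hg⟩
        rw [LinearMap.mem_ker.1 hf, zero_mul, mul_zero, sub_zero, smul_zero] at this
        exact ⟨⟨polyBracket f g, polyBracket_mem_parityPoly f.2 hg⟩, this, rfl⟩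
      · rintro _ ⟨f, hf, rfl⟩ f' hf' hsub
        refine ⟨⟨f', hf'⟩, ?_, rfl⟩
        exact (Q.oddOp_congr hsub).symm.trans hf
    obtain ⟨f, hf, hfX⟩ := hmem
    rw [← oddOp_X, ← LinearMap.mem_ker.1 hf]
    exact congrArg Q.oddOp (Subtype.ext hfX.symm)
  obtain ⟨h01, h12, h20⟩ := Q.spinA_commutator
  rw [h2, zero_mul, mul_zero, sub_zero] at h12 h20
  fin_cases i
  · exact (smul_eq_zero.1 h12.symm).resolve_left Complex.I_ne_zero
  · exact (smul_eq_zero.1 h20.symm).resolve_left Complex.I_ne_zero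
  · exact h2

theorem reduces_of_eq_smul_one {D K : Submodule ℂ H} [K.HasOrthogonalProjection]
    {B : Module.End ℂ D} (hB : IsEssentiallySelfAdjoint (toOperator B)) {c : ℝ}
    (hc : B = c • 1) : Reduces K (toOperator B) := by
  intro p hp
  have h1 : p.2 = c • p.1 := by
    refine graph_closure_subset hB.1 (S := {p | p.2 = c • p.1})
      (isClosed_eq (by fun_prop) (by fun_prop)) (fun v => ?_) hp
    rw [hc]
    rfl
  refine hB.mem_graph fun v => ?_
  rw [h1, hc, ← Complex.coe_smul, map_smul, inner_smul_left, Complex.conj_ofReal,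
    ← inner_smul_right]
  rfl

/-- When all of `𝒫¹` acts by scalars every line is reducing, so by irreducibility a line fills `H`.
-/
theorem finrank_eq_one (Q : Quantization (oddPolyConst s) H)
    (hQ : Q.IsAdmissible (linearPoly_le_oddPolyConst s)) (h0 : ∀ i, Q.spinA i = 0) :
    Module.finrank ℂ H = 1 := by
  obtain ⟨hH, hirr⟩ := hQ.irreducible
  obtain ⟨v, hv⟩ := exists_ne (0 : H)
  rcases hirr (Submodule.span ℂ {v}) fun b hb => by
    obtain ⟨c, hc⟩ := Q.linearPoly_induction (p := fun B => ∃ c : ℝ, B = c • 1)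
      ⟨1, (one_smul _ _).symm⟩ (fun i => ⟨0, by rw [h0, zero_smul]⟩)
      (fun A B ⟨a, ha⟩ ⟨b, hb⟩ => ⟨a + b, by rw [ha, hb, add_smul]⟩)
      (fun c A ⟨a, ha⟩ => ⟨c * a, by rw [ha, mul_smul]⟩) b hb
    exact reduces_of_eq_smul_one (Q.essentiallySelfAdjoint _) hc with hK | hK
  · exact absurd (Submodule.span_singleton_eq_bot.1 hK) hv
  · rw [← finrank_top, ← hK, finrank_span_singleton hv]

end Quantization

end SphereQuantization

end

theorem theorem2 (s : ℝ) (hs : 0 < s)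
    (H : Type*) [NormedAddCommGroup H] [InnerProductSpace ℂ H] [CompleteSpace H] :
    ¬ ∃ Q : SphereQuantization.Quantization (SphereQuantization.oddPolyConst s) H,
        Q.IsAdmissible (SphereQuantization.linearPoly_le_oddPolyConst s) ∧
          ¬ Q.IsTrivial (SphereQuantization.linearPoly_le_oddPolyConst s) := by
  rintro ⟨Q, hQ, htriv⟩
  have h0 := Q.spinA_eq_zero hs.ne' hQ
  exact htriv ⟨Q.finrank_eq_one hQ h0, h0⟩
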